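/- For a finite-dimensional real vector space $V$ let $\mathcal K(V)$ be the set of nonempty compact convex subsets of $V$. A valuation on $V$ is a function $\phi:\mathcal K(V)\to\mathbb C$ with $\phi(K\cup L)=\phi(K)+\phi(L)-\phi(K\cap L)$ whenever $K,L,K\cup L\in\mathcal K(V)$. Let $\mathcal G(V)$ be the complex vector space of all finite linear combinations of the valuations $K\mapsto\mu(K+A)$, where $\mu$ is a (complex-valued) measure on $V$ with polynomial density with respect to Lebesgue measure, $A\in\mathcal K(V)$, and $K+A$ is the Minkowski sum. Thus every $\phi\in\mathcal G(V)$ can be written as a finite sum $\phi=\sum_i\mu_i(\cdot+A_i)$. Let $V,W,X$ be finite-dimensional real vector spaces. For $\phi=\sum_i\mu_i(\cdot+A_i)\in\mathcal G(V)$ and $\psi=\sum_j\nu_j(\cdot+B_j)\in\mathcal G(W)$ put $$(\phi\boxtimes\psi)(M)=\sum_{i,j}(\mu_i\boxtimes\nu_j)\bigl(M+(A_i\times\{0\})+(\{0\}\times B_j)\bigr),\qquad M\in\mathcal K(V\times W),$$ where $\mu_i\boxtimes\nu_j$ is the product measure. Then $\phi\boxtimes\psi\in\mathcal G(V\times W)$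 is well defined, i.e. it depends only on $\phi$ and $\psi$ and not on the chosen representations. The exterior product $\boxtimes:\mathcal G(V)\times\mathcal G(W)\to\mathcal G(V\times W)$ is $\mathbb C$-bilinear, and for all $\phi\in\mathcal G(V)$, $\psi\in\mathcal G(W)$, $\eta\in\mathcal G(X)$ one has $$(\phi\boxtimes\psi)\boxtimes\eta=\phi\boxtimes(\psi\boxtimes\eta)$$ under the identification $(V\times W)\times X=V\times(W\times X)$. -/

import Mathlib

open MeasureTheory
open scoped Pointwise

set_option linter.unusedSectionVars false

noncomputable section

namespace ConvVal

/-! Throughout, `V`, `W`, `X` are finite-dimensional real vector spaces. They carry a norm only in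
order to have their canonical topology and Borel sets; no notion below depends on the choice of the
norm. The compact convex (nonempty) sets are Mathlib's `ConvexBody V`. -/

section Valuations

variable (V : Type*) [NormedAddCommGroup V] [NormedSpace ℝ V]

/-- The linear space of complex-valued valuations on the compact convex subsets of `V`:
`φ (K ∪ L) = φ K + φ L - φ (K ∩ L)` whenever `K ∪ L` is convex (then `K ∩ L` is nonempty, since
`K ∪ L` is connected). -/
def valuations : Submodule ℂ (ConvexBody V → ℂ) where
  carrier := {φ | ∀ K L U I : ConvexBody V, (U : Set V) = (K : Set V) ∪ (L : Set V) →
    (I : Set V) = (K : Set V) ∩ (L : Set V) → φ U = φ K + φ L - φ I}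
  zero_mem' := by intro K L U I _ _; simp
  add_mem' := by
    intro φ ψ hφ hψ K L U I hU hI
    simp only [Pi.add_apply, hφ K L U I hU hI, hψ K L U I hU hI]
    ring
  smul_mem' := by
    intro c φ hφ K L U I hU hI
    simp only [Pi.smul_apply, smul_eq_mul, hφ K L U I hU hI]
    ring

/-- The algebra of complex-valued polynomial functions on the real vector space `V`: the
subalgebra of `V → ℂ` generated by the real linear functionals. -/
def polyFun : Subalgebra ℂ (V → ℂ) :=
  Algebra.adjoin ℂ (Set.range fun (l : Module.Dual ℝ V) (x : V) => ((l x : ℝ) : ℂ))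

variable {V}

lemma polyFun_continuous [FiniteDimensional ℝ V] {p : V → ℂ} (hp : p ∈ polyFun V) :
    Continuous p := by
  induction hp using Algebra.adjoin_induction with
  | mem f hf =>
    obtain ⟨l, rfl⟩ := hf
    exact Complex.continuous_ofReal.comp l.continuous_of_finiteDimensional
  | algebraMap c => exact continuous_const
  | add f g _ _ hf hg => exact hf.add hg
  | mul f g _ _ hf hg => exact hf.mul hg

lemma polyFun_comp {W : Type*} [NormedAddCommGroup W] [NormedSpace ℝ W] (T : W →ₗ[ℝ] V)
    {p : V → ℂ} (hp : p ∈ polyFun V) : (fun y => p (T y)) ∈ polyFun W := by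
  induction hp using Algebra.adjoin_induction with
  | mem f hf =>
    obtain ⟨l, rfl⟩ := hf
    exact Algebra.subset_adjoin ⟨l.comp T, rfl⟩
  | algebraMap c => exact (polyFun W).algebraMap_mem c
  | add f g _ _ hf hg => exact (polyFun W).add_mem hf hg
  | mul f g _ _ hf hg => exact (polyFun W).mul_mem hf hg

end Valuations

/-- A (complex) measure on `V` with a polynomial density with respect to a Lebesgue measure, that
is, with respect to a translation invariant Radon measure `base ≠ 0`. It is given by the density
and the Lebesgue measure; its total variation is infinite in general, so it is evaluated on bounded
sets only. -/
structure PolyMeasure (V : Type*) [NormedAddCommGroup V] [NormedSpace ℝ V]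
    [MeasurableSpace V] where
  /-- the density -/
  density : V → ℂ
  density_mem : density ∈ polyFun V
  /-- the Lebesgue measure -/
  base : Measure V
  isHaar : base.IsAddHaarMeasure

section Measures

variable {V : Type*} [NormedAddCommGroup V] [NormedSpace ℝ V] [FiniteDimensional ℝ V]
  [MeasurableSpace V] [BorelSpace V]
variable {W : Type*} [NormedAddCommGroup W] [NormedSpace ℝ W] [FiniteDimensional ℝ W]
  [MeasurableSpace W] [BorelSpace W]

/-- The measure `μ(S)` of a set `S` (used for compact `S`). -/
def PolyMeasure.eval (μ : PolyMeasure V) (S : Set V) : ℂ :=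
  ∫ x in S, μ.density x ∂μ.base

/-- The product measure `μ ⊠ ν` on `V × W`, with density `p(x) q(y)` with respect to the product
of the Lebesgue measures. -/
def PolyMeasure.prod (μ : PolyMeasure V) (ν : PolyMeasure W) : PolyMeasure (V × W) where
  density z := μ.density z.1 * ν.density z.2
  density_mem := (polyFun (V × W)).mul_mem
    (polyFun_comp (LinearMap.fst ℝ V W) μ.density_mem)
    (polyFun_comp (LinearMap.snd ℝ V W) ν.density_mem)
  base := μ.base.prod ν.base
  isHaar := by
    have := μ.isHaar
    have := ν.isHaar
    infer_instance

/-- The product measure is the product on rectangles. -/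
lemma PolyMeasure.prod_eval (μ : PolyMeasure V) (ν : PolyMeasure W) (S : Set V) (T : Set W) :
    (μ.prod ν).eval (S ×ˢ T) = μ.eval S * ν.eval T := by
  have := μ.isHaar
  have := ν.isHaar
  exact setIntegral_prod_mul μ.density ν.density S T

/-- The function `K ↦ μ(K + A)`. -/
def shiftVal (μ : PolyMeasure V) (A : ConvexBody V) : ConvexBody V → ℂ :=
  fun K => μ.eval ((K : Set V) + (A : Set V))

/-- The functions `K ↦ μ(K + A)` are valuations. -/
lemma shiftVal_mem_valuations (μ : PolyMeasure V) (A : ConvexBody V) :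
    shiftVal μ A ∈ valuations V := by
  intro K L U I hU hI
  have := μ.isHaar
  have hc := polyFun_continuous μ.density_mem
  have hint : ∀ C : ConvexBody V, IntegrableOn μ.density ((C : Set V) + (A : Set V)) μ.base :=
    fun C => hc.continuousOn.integrableOn_compact (C.isCompact.add A.isCompact)
  have hmeas : ∀ C : ConvexBody V, MeasurableSet ((C : Set V) + (A : Set V)) :=
    fun C => (C.isCompact.add A.isCompact).isClosed.measurableSet
  have h1 : (U : Set V) + (A : Set V) = ((K : Set V) + A) ∪ ((L : Set V) + A) := by
    rw [hU, Set.union_add]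
  have h2 : (I : Set V) + (A : Set V) = ((K : Set V) + A) ∩ ((L : Set V) + A) := by
    apply Set.Subset.antisymm
    · rw [hI]
      exact Set.inter_add_subset
    · rintro x ⟨⟨k, hk, a, ha, rfl⟩, ⟨l, hl, b, hb, hx⟩⟩
      have hx : l + b = k + a := hx
      have hkU : k ∈ (U : Set V) := hU ▸ Or.inl hk
      have hlU : l ∈ (U : Set V) := hU ▸ Or.inr hl
      have hseg : segment ℝ k l ⊆ (K : Set V) ∪ L := hU ▸ U.convex.segment_subset hkU hlU
      obtain ⟨y, hy, hyK, hyL⟩ := isPreconnected_closed_iff.mp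
        (convex_segment (𝕜 := ℝ) k l).isPreconnected _ _ K.isClosed L.isClosed hseg
        ⟨k, left_mem_segment ℝ k l, hk⟩ ⟨l, right_mem_segment ℝ k l, hl⟩
      obtain ⟨s, t, hs, ht, hst, rfl⟩ := hy
      refine ⟨s • k + t • l, ?_, s • a + t • b, A.convex ha hb hs ht hst, ?_⟩
      · rw [hI]; exact ⟨hyK, hyL⟩
      · show s • k + t • l + (s • a + t • b) = k + a
        have : s • k + t • l + (s • a + t • b) = s • (k + a) + t • (l + b) := by
          simp only [smul_add]; abel
        rw [this, hx, ← add_smul, hst, one_smul]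
  simp only [shiftVal, PolyMeasure.eval]
  have h3 := integral_inter_add_sdiff (hmeas L) (hint K)
  have h4 : ((K : Set V) + (A : Set V)) ∪ ((L : Set V) + A)
      = ((L : Set V) + A) ∪ (((K : Set V) + (A : Set V)) \ ((L : Set V) + A)) := by
    rw [Set.union_sdiff_self, Set.union_comm]
  rw [h1, h2, h4, setIntegral_union Set.disjoint_sdiff_right ((hmeas K).diff (hmeas L)) (hint L)
    ((hint K).mono_set Set.sdiff_subset), ← h3]
  ring

variable (V) in
/-- The space `𝒢(V)` of finite linear combinations of the valuations `K ↦ μ(K + A)`, where `μ` is a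
measure with polynomial density and `A` is a compact convex set. -/
def genSpace : Submodule ℂ (ConvexBody V → ℂ) :=
  Submodule.span ℂ (Set.range fun q : PolyMeasure V × ConvexBody V => shiftVal q.1 q.2)

/-- `𝒢(V)` is a space of valuations. -/
lemma genSpace_le_valuations : genSpace V ≤ valuations V := by
  refine Submodule.span_le.mpr ?_
  rintro _ ⟨q, rfl⟩
  exact shiftVal_mem_valuations q.1 q.2

lemma shiftVal_mem (μ : PolyMeasure V) (A : ConvexBody V) : shiftVal μ A ∈ genSpace V :=
  Submodule.subset_span ⟨(μ, A), rfl⟩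

/-- `φ = ∑ i, μ i (· + A i)`. -/
def IsRep (φ : ConvexBody V → ℂ) {m : ℕ} (μ : Fin m → PolyMeasure V)
    (A : Fin m → ConvexBody V) : Prop :=
  ∀ K : ConvexBody V, φ K = ∑ i, shiftVal (μ i) (A i) K

/-- Every element of `𝒢(V)` has a representation `∑ i, μ i (· + A i)`. -/
lemma exists_isRep (φ : genSpace V) :
    ∃ (m : ℕ) (μ : Fin m → PolyMeasure V) (A : Fin m → ConvexBody V),
      IsRep (φ : ConvexBody V → ℂ) μ A := by
  obtain ⟨m, c, g, h⟩ := (Submodule.mem_span_set'.mp φ.2)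
  choose q hq using fun i => (g i).2
  refine ⟨m, fun i => ⟨c i • (q i).1.density, (polyFun V).smul_mem (q i).1.density_mem (c i),
    (q i).1.base, (q i).1.isHaar⟩, fun i => (q i).2, fun K => ?_⟩
  rw [← h, Finset.sum_apply]
  refine Finset.sum_congr rfl fun i _ => ?_
  rw [Pi.smul_apply, ← hq i]
  exact (integral_smul (c i) _).symm

/-- The product `A × B` of two compact convex sets. -/
def prodBody (A : ConvexBody V) (B : ConvexBody W) : ConvexBody (V × W) where
  carrier := (A : Set V) ×ˢ (B : Set W)
  convex' := A.convex.prod B.convex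
  isCompact' := A.isCompact.prod B.isCompact
  nonempty' := A.nonempty.prod B.nonempty

/-- The function
`M ↦ ∑ i, ∑ j, (μ i ⊠ ν j)(M + (A i × {0}) + ({0} × B j))` on the compact convex subsets of
`V × W`. -/
def prodFormula {m n : ℕ} (μ : Fin m → PolyMeasure V) (A : Fin m → ConvexBody V)
    (ν : Fin n → PolyMeasure W) (B : Fin n → ConvexBody W) : ConvexBody (V × W) → ℂ :=
  fun M => ∑ i, ∑ j, ((μ i).prod (ν j)).eval
    ((M : Set (V × W)) + ((A i : Set V) ×ˢ {0}) + ({0} ×ˢ (B j : Set W)))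

lemma prodFormula_mem {m n : ℕ} (μ : Fin m → PolyMeasure V) (A : Fin m → ConvexBody V)
    (ν : Fin n → PolyMeasure W) (B : Fin n → ConvexBody W) :
    prodFormula μ A ν B ∈ genSpace (V × W) := by
  have h : prodFormula μ A ν B = ∑ i, ∑ j,
      shiftVal ((μ i).prod (ν j)) (prodBody (A i) 0 + prodBody 0 (B j)) := by
    funext M
    simp only [Finset.sum_apply]
    refine Finset.sum_congr rfl fun i _ => Finset.sum_congr rfl fun j _ => ?_
    show _ = ((μ i).prod (ν j)).eval ((M : Set (V × W)) +
      (((A i : Set V) ×ˢ {0}) + ({0} ×ˢ (B j : Set W))))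
    rw [add_assoc]
  rw [h]
  exact Submodule.sum_mem _ fun i _ => Submodule.sum_mem _ fun j _ => shiftVal_mem _ _

/-- The exterior product `φ ⊠ ψ ∈ 𝒢(V × W)`, computed from some representation
`φ = ∑ i, μ i (· + A i)` and some representation `ψ = ∑ j, ν j (· + B j)`. -/
def extProd (φ : genSpace V) (ψ : genSpace W) : genSpace (V × W) :=
  ⟨prodFormula (exists_isRep φ).choose_spec.choose
      (exists_isRep φ).choose_spec.choose_spec.choose
      (exists_isRep ψ).choose_spec.choose
      (exists_isRep ψ).choose_spec.choose_spec.choose,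
    prodFormula_mem _ _ _ _⟩

/-- The image of a compact convex set under the identification `(V × W) × X = V × (W × X)`. -/
def assocBody {X : Type*} [NormedAddCommGroup X] [NormedSpace ℝ X]
    (M : ConvexBody ((V × W) × X)) : ConvexBody (V × (W × X)) where
  carrier := (LinearEquiv.prodAssoc ℝ V W X) '' (M : Set ((V × W) × X))
  convex' := M.convex.linear_image (LinearEquiv.prodAssoc ℝ V W X).toLinearMap
  isCompact' := M.isCompact.image (Homeomorph.prodAssoc V W X).continuous
  nonempty' := M.nonempty.image _

end Measures

end ConvVal

end

/-! The point is Fubini. Let `N` be a compact convex set in `V × W` with slices `N_v = {w | (v, w) ∈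
N}`. Adding `{0} × B` to `N` only adds `B` to each slice, so if `μ` has density `p`, then `∑ j, (μ ⊠
ν j)(N + {0} × B j) = ∫ p(v) ψ(N_v) dv`, with `ψ` read as `0` on empty slices. The right side sees
only `ψ`, not its representation (`IsRep.sum_prod_eval_snd`); the same holds with the factors
exchanged (`IsRep.sum_prod_eval_fst`). Taking `N = M + A i × {0}`, and then `N = M + {0} × B j`,
replaces the two representations one after the other (`IsRep.prodFormula_eq`).

Once any representation may be used, the algebraic laws come from convenient choices. Sums are
represented by concatenation and scalar multiples by scaling densities. The product `φ ⊠ ψ` is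
represented by the measures `μ i ⊠ ν j` and the bodies `A i × B j` (`isRep_extProd`), so
associativity reduces to that of products of measures and of sets. -/

noncomputable section

namespace ConvVal

/-! ### Independence of the chosen representations. -/

section WellDefined

variable {V : Type*} [NormedAddCommGroup V] [NormedSpace ℝ V] [FiniteDimensional ℝ V]
  [MeasurableSpace V] [BorelSpace V]
variable {W : Type*} [NormedAddCommGroup W] [NormedSpace ℝ W] [FiniteDimensional ℝ W]
  [MeasurableSpace W] [BorelSpace W]

open Classical in
/-- The extension of a function on convex bodies to all sets, by `0`. -/
def extendZero (φ : ConvexBody V → ℂ) (S : Set V) : ℂ :=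
  if h : Convex ℝ S ∧ IsCompact S ∧ S.Nonempty then φ ⟨S, h.1, h.2.1, h.2.2⟩ else 0

/-- The value `0` is the right one on the empty set, because `∅ + A = ∅` has measure zero. Slices of
a body may be empty, so this case does occur. -/
lemma eval_add_eq_extendZero (μ : PolyMeasure V) (A : ConvexBody V) {S : Set V}
    (hS : Convex ℝ S) (hS' : IsCompact S) :
    μ.eval (S + (A : Set V)) = extendZero (shiftVal μ A) S := by
  rcases S.eq_empty_or_nonempty with rfl | hne
  · simp [extendZero, PolyMeasure.eval]
  · rw [extendZero, dif_pos ⟨hS, hS', hne⟩]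
    rfl

lemma IsRep.extendZero_eq {φ : ConvexBody V → ℂ} {m : ℕ} {μ : Fin m → PolyMeasure V}
    {A : Fin m → ConvexBody V} (h : IsRep φ μ A) (S : Set V) :
    extendZero φ S = ∑ i, extendZero (shiftVal (μ i) (A i)) S := by
  by_cases hS : Convex ℝ S ∧ IsCompact S ∧ S.Nonempty
  · simp only [extendZero, dif_pos hS]
    exact h _
  · simp [extendZero, dif_neg hS]

/-! ### Slices of subsets of the product space. -/

lemma isCompact_fstSlice {M : Set (V × W)} (hM : IsCompact M) (w : W) :
    IsCompact ((fun v => (v, w)) ⁻¹' M) :=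
  (Topology.IsClosedEmbedding.of_continuous_injective_isClosedMap (by fun_prop)
    (fun _ _ h => (Prod.ext_iff.mp h).1) (isClosedMap_prodMk_right w)).isCompact_preimage hM

lemma isCompact_sndSlice {M : Set (V × W)} (hM : IsCompact M) (v : V) :
    IsCompact ((fun w => (v, w)) ⁻¹' M) :=
  (Topology.IsClosedEmbedding.of_continuous_injective_isClosedMap (by fun_prop)
    (fun _ _ h => (Prod.ext_iff.mp h).2) (isClosedMap_prodMk_left v)).isCompact_preimage hM

lemma convex_fstSlice {M : Set (V × W)} (hM : Convex ℝ M) (w : W) :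
    Convex ℝ ((fun v => (v, w)) ⁻¹' M) := by
  intro x hx y hy a b ha hb hab
  have h := hM hx hy ha hb hab
  simpa [← add_smul, hab] using h

lemma convex_sndSlice {M : Set (V × W)} (hM : Convex ℝ M) (v : V) :
    Convex ℝ ((fun w => (v, w)) ⁻¹' M) := by
  intro x hx y hy a b ha hb hab
  have h := hM hx hy ha hb hab
  simpa [← add_smul, hab] using h

/-- A summand in `A × {0}` does not move the `W`-coordinate, so the sum at height `w` uses only
points of `M` at height `w`. -/
lemma fstSlice_add (M : Set (V × W)) (A : Set V) (w : W) :
    (fun v => (v, w)) ⁻¹' (M + A ×ˢ {0}) = (fun v => (v, w)) ⁻¹' M + A := by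
  ext v
  constructor
  · rintro ⟨⟨x, y⟩, hx, ⟨a, b⟩, ⟨ha, hb⟩, h⟩
    simp only [Set.mem_singleton_iff, Prod.mk_add_mk, Prod.mk.injEq] at hb h
    obtain ⟨rfl, rfl⟩ := h
    subst hb
    exact ⟨x, by simpa using hx, a, ha, rfl⟩
  · rintro ⟨x, hx, a, ha, rfl⟩
    exact ⟨(x, w), hx, (a, 0), ⟨ha, rfl⟩, by simp⟩

lemma sndSlice_add (M : Set (V × W)) (B : Set W) (v : V) :
    (fun w => (v, w)) ⁻¹' (M + {0} ×ˢ B) = (fun w => (v, w)) ⁻¹' M + B := by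
  ext w
  constructor
  · rintro ⟨⟨x, y⟩, hx, ⟨a, b⟩, ⟨ha, hb⟩, h⟩
    simp only [Set.mem_singleton_iff, Prod.mk_add_mk, Prod.mk.injEq] at ha h
    obtain ⟨rfl, rfl⟩ := h
    subst ha
    exact ⟨y, by simpa using hx, b, hb, rfl⟩
  · rintro ⟨y, hy, b, hb, rfl⟩
    exact ⟨(v, y), hy, (0, b), ⟨rfl, hb⟩, by simp⟩

/-! ### Fubini for product measures on compact sets. -/

lemma PolyMeasure.integrable_indicator (μ : PolyMeasure V) {S : Set V} (hS : IsCompact S) :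
    Integrable (S.indicator μ.density) μ.base := by
  have := μ.isHaar
  exact (integrable_indicator_iff hS.isClosed.measurableSet).mpr
    ((polyFun_continuous μ.density_mem).continuousOn.integrableOn_compact hS)

/-- This is the inner integral in Fubini: the density is a product, and its factor at `w` is
constant in `v`. -/
lemma PolyMeasure.integral_indicator_fstSlice (μ : PolyMeasure V) (ν : PolyMeasure W)
    {S : Set (V × W)} (hS : IsCompact S) (w : W) :
    ∫ v, S.indicator (μ.prod ν).density (v, w) ∂μ.base =
      ν.density w * μ.eval ((fun v => (v, w)) ⁻¹' S) := by
  rw [PolyMeasure.eval, ← integral_indicator (isCompact_fstSlice hS w).isClosed.measurableSet,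
    ← integral_const_mul]
  congr 1 with v
  by_cases h : (v, w) ∈ S
  · simp [Set.indicator, h, PolyMeasure.prod, mul_comm]
  · simp [Set.indicator, h]

lemma PolyMeasure.integral_indicator_sndSlice (μ : PolyMeasure V) (ν : PolyMeasure W)
    {S : Set (V × W)} (hS : IsCompact S) (v : V) :
    ∫ w, S.indicator (μ.prod ν).density (v, w) ∂ν.base =
      μ.density v * ν.eval ((fun w => (v, w)) ⁻¹' S) := by
  rw [PolyMeasure.eval, ← integral_indicator (isCompact_sndSlice hS v).isClosed.measurableSet,
    ← integral_const_mul]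
  congr 1 with w
  by_cases h : (v, w) ∈ S
  · simp [Set.indicator, h, PolyMeasure.prod]
  · simp [Set.indicator, h]

/-- Needed to exchange the finite sum over a representation with the integral over the slices. -/
lemma PolyMeasure.integrable_fstSlice (μ : PolyMeasure V) (ν : PolyMeasure W)
    {S : Set (V × W)} (hS : IsCompact S) :
    Integrable (fun w => ν.density w * μ.eval ((fun v => (v, w)) ⁻¹' S)) ν.base := by
  have := μ.isHaar
  have := ν.isHaar
  simp only [← integral_indicator_fstSlice μ ν hS]
  exact ((μ.prod ν).integrable_indicator hS).integral_prod_right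

lemma PolyMeasure.integrable_sndSlice (μ : PolyMeasure V) (ν : PolyMeasure W)
    {S : Set (V × W)} (hS : IsCompact S) :
    Integrable (fun v => μ.density v * ν.eval ((fun w => (v, w)) ⁻¹' S)) μ.base := by
  have := μ.isHaar
  have := ν.isHaar
  simp only [← integral_indicator_sndSlice μ ν hS]
  exact ((μ.prod ν).integrable_indicator hS).integral_prod_left

lemma PolyMeasure.prod_eval_eq_integral_fstSlice (μ : PolyMeasure V) (ν : PolyMeasure W)
    {S : Set (V × W)} (hS : IsCompact S) :
    (μ.prod ν).eval S = ∫ w, ν.density w * μ.eval ((fun v => (v, w)) ⁻¹' S) ∂ν.base := by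
  have := μ.isHaar
  have := ν.isHaar
  simp only [← integral_indicator_fstSlice μ ν hS]
  rw [PolyMeasure.eval, ← integral_indicator hS.isClosed.measurableSet]
  exact integral_prod_symm _ ((μ.prod ν).integrable_indicator hS)

lemma PolyMeasure.prod_eval_eq_integral_sndSlice (μ : PolyMeasure V) (ν : PolyMeasure W)
    {S : Set (V × W)} (hS : IsCompact S) :
    (μ.prod ν).eval S = ∫ v, μ.density v * ν.eval ((fun w => (v, w)) ⁻¹' S) ∂μ.base := by
  have := μ.isHaar
  have := ν.isHaar
  simp only [← integral_indicator_sndSlice μ ν hS]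
  rw [PolyMeasure.eval, ← integral_indicator hS.isClosed.measurableSet]
  exact integral_prod _ ((μ.prod ν).integrable_indicator hS)

/-- The sum of the values of `μ i ⊠ ν` on `N + (A i × {0})` is an integral over the slices of `N`
that involves the `μ i` and `A i` only through `φ`. -/
lemma IsRep.sum_prod_eval_fst {φ : ConvexBody V → ℂ} {m : ℕ} {μ : Fin m → PolyMeasure V}
    {A : Fin m → ConvexBody V} (h : IsRep φ μ A) (ν : PolyMeasure W) (N : ConvexBody (V × W)) :
    ∑ i, ((μ i).prod ν).eval ((N : Set (V × W)) + (A i : Set V) ×ˢ {0}) =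
      ∫ w, ν.density w * extendZero φ ((fun v => (v, w)) ⁻¹' (N : Set (V × W))) ∂ν.base := by
  have hc (i) : IsCompact ((N : Set (V × W)) + (A i : Set V) ×ˢ {0}) :=
    N.isCompact.add ((A i).isCompact.prod isCompact_singleton)
  simp only [PolyMeasure.prod_eval_eq_integral_fstSlice _ _ (hc _)]
  rw [← integral_finsetSum _ fun i _ => (μ i).integrable_fstSlice ν (hc i)]
  congr 1 with w
  -- For fixed `w`, the sum over `i` is the representation of `φ` evaluated at the slice of `N`,
  -- which may be empty.
  rw [h.extendZero_eq, Finset.mul_sum]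
  refine Finset.sum_congr rfl fun i _ => ?_
  rw [fstSlice_add, eval_add_eq_extendZero _ _ (convex_fstSlice N.convex w)
    (isCompact_fstSlice N.isCompact w)]

/-- The sum of the values of `μ ⊠ ν j` on `N + ({0} × B j)` is an integral over the slices of `N`
that involves the `ν j` and `B j` only through `ψ`. -/
lemma IsRep.sum_prod_eval_snd {ψ : ConvexBody W → ℂ} {n : ℕ} {ν : Fin n → PolyMeasure W}
    {B : Fin n → ConvexBody W} (h : IsRep ψ ν B) (μ : PolyMeasure V) (N : ConvexBody (V × W)) :
    ∑ j, (μ.prod (ν j)).eval ((N : Set (V × W)) + {0} ×ˢ (B j : Set W)) =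
      ∫ v, μ.density v * extendZero ψ ((fun w => (v, w)) ⁻¹' (N : Set (V × W))) ∂μ.base := by
  have hc (j) : IsCompact ((N : Set (V × W)) + {0} ×ˢ (B j : Set W)) :=
    N.isCompact.add (isCompact_singleton.prod (B j).isCompact)
  simp only [PolyMeasure.prod_eval_eq_integral_sndSlice _ _ (hc _)]
  rw [← integral_finsetSum _ fun j _ => μ.integrable_sndSlice (ν j) (hc j)]
  congr 1 with v
  rw [h.extendZero_eq, Finset.mul_sum]
  refine Finset.sum_congr rfl fun j _ => ?_
  rw [sndSlice_add, eval_add_eq_extendZero _ _ (convex_sndSlice N.convex v)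
    (isCompact_sndSlice N.isCompact v)]

/-- The mixed formula, with the old representation of `φ` and the new one of `ψ`, links the two
sides, so only one factor changes at a time. -/
lemma IsRep.prodFormula_eq {φ : ConvexBody V → ℂ} {ψ : ConvexBody W → ℂ} {m m' n n' : ℕ}
    {μ : Fin m → PolyMeasure V} {A : Fin m → ConvexBody V}
    {μ' : Fin m' → PolyMeasure V} {A' : Fin m' → ConvexBody V}
    {ν : Fin n → PolyMeasure W} {B : Fin n → ConvexBody W}
    {ν' : Fin n' → PolyMeasure W} {B' : Fin n' → ConvexBody W}
    (hμ : IsRep φ μ A) (hμ' : IsRep φ μ' A') (hν : IsRep ψ ν B) (hν' : IsRep ψ ν' B') :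
    prodFormula μ A ν B = prodFormula μ' A' ν' B' := by
  funext M
  trans prodFormula μ A ν' B' M
  -- For fixed `i` the summand `A i × {0}` is absorbed into the body that is sliced.
  · refine Finset.sum_congr rfl fun i _ => ?_
    exact (hν.sum_prod_eval_snd (μ i) (M + prodBody (A i) 0)).trans
      (hν'.sum_prod_eval_snd (μ i) (M + prodBody (A i) 0)).symm
  -- Here `{0} × B' j` has to be absorbed instead: it is moved next to `M`, and `j` becomes the
  -- outer summation index.
  · simp only [prodFormula, add_right_comm (M : Set (V × W))]
    rw [Finset.sum_comm, Finset.sum_comm (s := (Finset.univ : Finset (Fin m')))]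
    refine Finset.sum_congr rfl fun j _ => ?_
    exact (hμ.sum_prod_eval_fst (ν' j) (M + prodBody 0 (B' j))).trans
      (hμ'.sum_prod_eval_fst (ν' j) (M + prodBody 0 (B' j))).symm

/-- Frees `extProd` from the representations chosen in its definition; the algebraic laws below rest
on this. -/
lemma coe_extProd {φ : genSpace V} {ψ : genSpace W} {m n : ℕ}
    {μ : Fin m → PolyMeasure V} {A : Fin m → ConvexBody V}
    {ν : Fin n → PolyMeasure W} {B : Fin n → ConvexBody W}
    (hμ : IsRep (φ : ConvexBody V → ℂ) μ A) (hν : IsRep (ψ : ConvexBody W → ℂ) ν B) :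
    (extProd φ ψ : ConvexBody (V × W) → ℂ) = prodFormula μ A ν B :=
  IsRep.prodFormula_eq (exists_isRep φ).choose_spec.choose_spec.choose_spec hμ
    (exists_isRep ψ).choose_spec.choose_spec.choose_spec hν

end WellDefined

/-! ### Bilinearity. -/

section Bilinear

variable {V : Type*} [NormedAddCommGroup V] [NormedSpace ℝ V] [FiniteDimensional ℝ V]
  [MeasurableSpace V] [BorelSpace V]
variable {W : Type*} [NormedAddCommGroup W] [NormedSpace ℝ W] [FiniteDimensional ℝ W]
  [MeasurableSpace W] [BorelSpace W]

/-- The multiple of a measure by a complex number. -/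
def PolyMeasure.scale (c : ℂ) (μ : PolyMeasure V) : PolyMeasure V where
  density := c • μ.density
  density_mem := (polyFun V).smul_mem μ.density_mem c
  base := μ.base
  isHaar := μ.isHaar

lemma PolyMeasure.scale_eval (c : ℂ) (μ : PolyMeasure V) (S : Set V) :
    (μ.scale c).eval S = c * μ.eval S :=
  integral_const_mul c _

lemma PolyMeasure.scale_prod (c : ℂ) (μ : PolyMeasure V) (ν : PolyMeasure W) :
    (μ.scale c).prod ν = (μ.prod ν).scale c := by
  simp only [PolyMeasure.scale, PolyMeasure.prod, PolyMeasure.mk.injEq, and_true]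
  funext z
  simp [mul_assoc]

lemma PolyMeasure.prod_scale (c : ℂ) (μ : PolyMeasure V) (ν : PolyMeasure W) :
    μ.prod (ν.scale c) = (μ.prod ν).scale c := by
  simp only [PolyMeasure.scale, PolyMeasure.prod, PolyMeasure.mk.injEq, and_true]
  funext z
  simp [mul_left_comm]

lemma IsRep.add {φ φ' : ConvexBody V → ℂ} {m m' : ℕ}
    {μ : Fin m → PolyMeasure V} {A : Fin m → ConvexBody V}
    {μ' : Fin m' → PolyMeasure V} {A' : Fin m' → ConvexBody V}
    (h : IsRep φ μ A) (h' : IsRep φ' μ' A') :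
    IsRep (φ + φ') (Fin.append μ μ') (Fin.append A A') := by
  intro K
  simp [Fin.sum_univ_add, h K, h' K]

lemma IsRep.smul {φ : ConvexBody V → ℂ} {m : ℕ}
    {μ : Fin m → PolyMeasure V} {A : Fin m → ConvexBody V} (h : IsRep φ μ A) (c : ℂ) :
    IsRep (c • φ) (fun i => (μ i).scale c) A := by
  intro K
  simp [shiftVal, PolyMeasure.scale_eval, h K, Finset.mul_sum]

lemma extProd_add_left (φ φ' : genSpace V) (ψ : genSpace W) :
    extProd (φ + φ') ψ = extProd φ ψ + extProd φ' ψ := by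
  obtain ⟨m, μ, A, h⟩ := exists_isRep φ
  obtain ⟨m', μ', A', h'⟩ := exists_isRep φ'
  obtain ⟨n, ν, B, hν⟩ := exists_isRep ψ
  refine Subtype.ext (funext fun M => ?_)
  -- `φ + φ'` is given explicitly because the concatenation represents the sum of the underlying
  -- functions, which agrees with the coercion of the sum only by unfolding.
  rw [coe_extProd (φ := φ + φ') (h.add h') hν, Submodule.coe_add, coe_extProd h hν,
    coe_extProd h' hν]
  simp [prodFormula, Fin.sum_univ_add]

lemma extProd_add_right (φ : genSpace V) (ψ ψ' : genSpace W) :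
    extProd φ (ψ + ψ') = extProd φ ψ + extProd φ ψ' := by
  obtain ⟨m, μ, A, hμ⟩ := exists_isRep φ
  obtain ⟨n, ν, B, h⟩ := exists_isRep ψ
  obtain ⟨n', ν', B', h'⟩ := exists_isRep ψ'
  refine Subtype.ext (funext fun M => ?_)
  rw [coe_extProd (ψ := ψ + ψ') hμ (h.add h'), Submodule.coe_add, coe_extProd hμ h,
    coe_extProd hμ h']
  simp [prodFormula, Fin.sum_univ_add, Finset.sum_add_distrib]

lemma extProd_smul_left (c : ℂ) (φ : genSpace V) (ψ : genSpace W) :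
    extProd (c • φ) ψ = c • extProd φ ψ := by
  obtain ⟨m, μ, A, hμ⟩ := exists_isRep φ
  obtain ⟨n, ν, B, hν⟩ := exists_isRep ψ
  refine Subtype.ext (funext fun M => ?_)
  rw [coe_extProd (φ := c • φ) (hμ.smul c) hν, Submodule.coe_smul, coe_extProd hμ hν]
  simp [prodFormula, PolyMeasure.scale_prod, PolyMeasure.scale_eval, Finset.mul_sum]

lemma extProd_smul_right (c : ℂ) (φ : genSpace V) (ψ : genSpace W) :
    extProd φ (c • ψ) = c • extProd φ ψ := by
  obtain ⟨m, μ, A, hμ⟩ := exists_isRep φ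
  obtain ⟨n, ν, B, hν⟩ := exists_isRep ψ
  refine Subtype.ext (funext fun M => ?_)
  rw [coe_extProd (ψ := c • ψ) hμ (hν.smul c), Submodule.coe_smul, coe_extProd hμ hν]
  simp [prodFormula, PolyMeasure.prod_scale, PolyMeasure.scale_eval, Finset.mul_sum]

end Bilinear

/-! ### Associativity. -/

section Assoc

variable {V : Type*} [NormedAddCommGroup V] [NormedSpace ℝ V] [FiniteDimensional ℝ V]
  [MeasurableSpace V] [BorelSpace V]
variable {W : Type*} [NormedAddCommGroup W] [NormedSpace ℝ W] [FiniteDimensional ℝ W]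
  [MeasurableSpace W] [BorelSpace W]
variable {X : Type*} [NormedAddCommGroup X] [NormedSpace ℝ X] [FiniteDimensional ℝ X]
  [MeasurableSpace X] [BorelSpace X]

/-- The representation of `φ ⊠ ψ` obtained from representations of `φ` and `ψ`. -/
lemma isRep_extProd {φ : genSpace V} {ψ : genSpace W} {m n : ℕ}
    {μ : Fin m → PolyMeasure V} {A : Fin m → ConvexBody V}
    {ν : Fin n → PolyMeasure W} {B : Fin n → ConvexBody W}
    (hμ : IsRep (φ : ConvexBody V → ℂ) μ A) (hν : IsRep (ψ : ConvexBody W → ℂ) ν B) :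
    IsRep (extProd φ ψ : ConvexBody (V × W) → ℂ)
      (fun k : Fin (m * n) =>
        (μ (finProdFinEquiv.symm k).1).prod (ν (finProdFinEquiv.symm k).2))
      (fun k => prodBody (A (finProdFinEquiv.symm k).1) (B (finProdFinEquiv.symm k).2)) := by
  intro M
  rw [coe_extProd hμ hν, Equiv.sum_comp finProdFinEquiv.symm
    fun p : Fin m × Fin n => shiftVal ((μ p.1).prod (ν p.2)) (prodBody (A p.1) (B p.2)) M,
    Fintype.sum_prod_type]
  refine Finset.sum_congr rfl fun i _ => Finset.sum_congr rfl fun j _ => ?_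
  -- The two translates merge: `(A × {0}) + ({0} × B) = A × B`.
  rw [shiftVal, add_assoc, Set.prod_add_prod_comm, Set.singleton_zero, Set.singleton_zero,
    add_zero, zero_add]
  rfl

/-- Reassociation preserves the product of the base measures, and the densities correspond by
associativity of multiplication in `ℂ`. -/
lemma PolyMeasure.prod_assoc_eval (μ : PolyMeasure V) (ν : PolyMeasure W) (ρ : PolyMeasure X)
    (S : Set ((V × W) × X)) :
    (μ.prod (ν.prod ρ)).eval (LinearEquiv.prodAssoc ℝ V W X '' S) = ((μ.prod ν).prod ρ).eval S := by
  have := μ.isHaar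
  have := ν.isHaar
  have := ρ.isHaar
  have h := (measurePreserving_prodAssoc μ.base ν.base ρ.base).setIntegral_image_emb
    MeasurableEquiv.prodAssoc.measurableEmbedding (μ.prod (ν.prod ρ)).density S
  refine h.trans ?_
  simp [PolyMeasure.eval, PolyMeasure.prod, mul_assoc, MeasurableEquiv.prodAssoc]

lemma extProd_assoc (φ : genSpace V) (ψ : genSpace W) (η : genSpace X)
    (M : ConvexBody ((V × W) × X)) :
    (extProd (extProd φ ψ) η : ConvexBody ((V × W) × X) → ℂ) M =
      (extProd φ (extProd ψ η) : ConvexBody (V × (W × X)) → ℂ) (assocBody M) := by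
  obtain ⟨m, μ, A, hμ⟩ := exists_isRep φ
  obtain ⟨n, ν, B, hν⟩ := exists_isRep ψ
  obtain ⟨k, ρ, C, hρ⟩ := exists_isRep η
  rw [isRep_extProd (isRep_extProd hμ hν) hρ M,
    isRep_extProd hμ (isRep_extProd hν hρ) (assocBody M)]
  -- The flattened indices in `Fin (m * n * k)` and `Fin (m * (n * k))` are unpacked until both
  -- sides are sums over triples `(i, j, l)`, which are then compared term by term.
  simp only [Equiv.sum_comp finProdFinEquiv.symm
    fun p => shiftVal (((μ (finProdFinEquiv.symm p.1).1).prod (ν (finProdFinEquiv.symm p.1).2)).prod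
      (ρ p.2)) (prodBody (prodBody (A (finProdFinEquiv.symm p.1).1)
        (B (finProdFinEquiv.symm p.1).2)) (C p.2)) M,
    Equiv.sum_comp finProdFinEquiv.symm
    fun p => shiftVal ((μ p.1).prod ((ν (finProdFinEquiv.symm p.2).1).prod
      (ρ (finProdFinEquiv.symm p.2).2))) (prodBody (A p.1)
        (prodBody (B (finProdFinEquiv.symm p.2).1) (C (finProdFinEquiv.symm p.2).2)))
        (assocBody M), Fintype.sum_prod_type]
  rw [Equiv.sum_comp finProdFinEquiv.symm
    fun p => ∑ l, shiftVal (((μ p.1).prod (ν p.2)).prod (ρ l))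
      (prodBody (prodBody (A p.1) (B p.2)) (C l)) M, Fintype.sum_prod_type]
  refine Finset.sum_congr rfl fun i _ => ?_
  rw [Equiv.sum_comp finProdFinEquiv.symm
    fun p => shiftVal ((μ i).prod ((ν p.1).prod (ρ p.2)))
      (prodBody (A i) (prodBody (B p.1) (C p.2))) (assocBody M), Fintype.sum_prod_type]
  refine Finset.sum_congr rfl fun j _ => Finset.sum_congr rfl fun l _ => ?_
  -- The identification is linear, so it maps a Minkowski sum to the sum of the images. What remains
  -- is that it carries `(A × B) × C` onto `A × (B × C)`.
  rw [shiftVal, shiftVal, ← PolyMeasure.prod_assoc_eval, Set.image_add]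
  congr 2
  ext ⟨v, w, x⟩
  constructor
  · rintro ⟨⟨⟨a, b⟩, c⟩, ⟨⟨ha, hb⟩, hc⟩, h⟩
    exact h ▸ ⟨ha, hb, hc⟩
  · rintro ⟨ha, hb, hc⟩
    exact ⟨((v, w), x), ⟨⟨ha, hb⟩, hc⟩, rfl⟩

end Assoc

end ConvVal

end

theorem proposition1p1p3
    {V : Type*} [NormedAddCommGroup V] [NormedSpace ℝ V] [FiniteDimensional ℝ V]
    [MeasurableSpace V] [BorelSpace V]
    {W : Type*} [NormedAddCommGroup W] [NormedSpace ℝ W] [FiniteDimensional ℝ W]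
    [MeasurableSpace W] [BorelSpace W]
    {X : Type*} [NormedAddCommGroup X] [NormedSpace ℝ X] [FiniteDimensional ℝ X]
    [MeasurableSpace X] [BorelSpace X] :
    -- the defining formula does not depend on the representations
    (∀ (φ : ConvVal.genSpace V) (ψ : ConvVal.genSpace W)
      (m m' n n' : ℕ)
      (μ : Fin m → ConvVal.PolyMeasure V) (A : Fin m → ConvexBody V)
      (μ' : Fin m' → ConvVal.PolyMeasure V) (A' : Fin m' → ConvexBody V)
      (ν : Fin n → ConvVal.PolyMeasure W) (B : Fin n → ConvexBody W)
      (ν' : Fin n' → ConvVal.PolyMeasure W) (B' : Fin n' → ConvexBody W),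
      ConvVal.IsRep (φ : ConvexBody V → ℂ) μ A → ConvVal.IsRep (φ : ConvexBody V → ℂ) μ' A' →
      ConvVal.IsRep (ψ : ConvexBody W → ℂ) ν B → ConvVal.IsRep (ψ : ConvexBody W → ℂ) ν' B' →
      ConvVal.prodFormula μ A ν B = ConvVal.prodFormula μ' A' ν' B') ∧
    -- the exterior product is given by that formula, for every choice of representations
    (∀ (φ : ConvVal.genSpace V) (ψ : ConvVal.genSpace W) (m n : ℕ)
      (μ : Fin m → ConvVal.PolyMeasure V) (A : Fin m → ConvexBody V)
      (ν : Fin n → ConvVal.PolyMeasure W) (B : Fin n → ConvexBody W),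
      ConvVal.IsRep (φ : ConvexBody V → ℂ) μ A → ConvVal.IsRep (ψ : ConvexBody W → ℂ) ν B →
      ∀ M : ConvexBody (V × W),
        (ConvVal.extProd φ ψ : ConvexBody (V × W) → ℂ) M = ConvVal.prodFormula μ A ν B M) ∧
    -- it is bilinear
    (∀ (φ φ' : ConvVal.genSpace V) (ψ : ConvVal.genSpace W),
      ConvVal.extProd (φ + φ') ψ = ConvVal.extProd φ ψ + ConvVal.extProd φ' ψ) ∧
    (∀ (c : ℂ) (φ : ConvVal.genSpace V) (ψ : ConvVal.genSpace W),
      ConvVal.extProd (c • φ) ψ = c • ConvVal.extProd φ ψ) ∧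
    (∀ (φ : ConvVal.genSpace V) (ψ ψ' : ConvVal.genSpace W),
      ConvVal.extProd φ (ψ + ψ') = ConvVal.extProd φ ψ + ConvVal.extProd φ ψ') ∧
    (∀ (c : ℂ) (φ : ConvVal.genSpace V) (ψ : ConvVal.genSpace W),
      ConvVal.extProd φ (c • ψ) = c • ConvVal.extProd φ ψ) ∧
    -- it is associative
    (∀ (φ : ConvVal.genSpace V) (ψ : ConvVal.genSpace W) (η : ConvVal.genSpace X)
      (M : ConvexBody ((V × W) × X)),
      (ConvVal.extProd (ConvVal.extProd φ ψ) η : ConvexBody ((V × W) × X) → ℂ) M =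
        (ConvVal.extProd φ (ConvVal.extProd ψ η) : ConvexBody (V × (W × X)) → ℂ)
          (ConvVal.assocBody M)) := by
  refine ⟨fun φ ψ m m' n n' μ A μ' A' ν B ν' B' hμ hμ' hν hν' => hμ.prodFormula_eq hμ' hν hν',
    fun φ ψ m n μ A ν B hμ hν M => ?_, ConvVal.extProd_add_left, ConvVal.extProd_smul_left,
    ConvVal.extProd_add_right, ConvVal.extProd_smul_right, ConvVal.extProd_assoc⟩
  rw [ConvVal.coe_extProd hμ hν]
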